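/- Let $X$ be a separable infinite-dimensional real or complex Banach space and let $N\ge 2$. For bounded linear operators $T_1,\dots,T_N$ on $X$, let $\text{d-}\mathcal{HC}(T_1,\dots,T_N)$ denote the set of d-hypercyclic vectors, i.e. of all $x\in X$ for which $\{(T_1^n x,\dots,T_N^n x): n\in\mathbb{N}\}$ is dense in $X^N$; the operators are densely d-hypercyclic if this set is dense in $X$, and a d-hypercyclic manifold is a (not necessarily closed) linear subspace of $X$ all of whose nonzero vectors are d-hypercyclic. Then there exist bounded linear operators $T_1,\dots,T_N$ on $X$ which are densely d-hypercyclic, which have no d-hypercyclic manifold that is dense in $X$, and for which every nonzero linear subspace of $X$ contained in $\text{d-}\mathcal{HC}(T_1,\dots,T_N)\cup\{0\}$ is one-dimensional. -/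

import Mathlib

/-- The set of d-hypercyclic vectors of the operators `T 0, …, T (N - 1)`: the vectors `x` for which
the joint orbit `{(T 0 ^ n x, …, T (N - 1) ^ n x) : n ∈ ℕ}` is dense in `X ^ N`
(with the product topology). -/
def dHypercyclicVectors {𝕜 : Type*} [RCLike 𝕜] {X : Type*} [NormedAddCommGroup X]
    [NormedSpace 𝕜 X] {N : ℕ} (T : Fin N → X →L[𝕜] X) : Set X :=
  {x | Dense (Set.range fun n : ℕ => fun i : Fin N => (T i ^ n) x)}

/-- The operators are densely d-hypercyclic if their d-hypercyclic vectors are dense in `X`. -/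
def DenselyDHypercyclic {𝕜 : Type*} [RCLike 𝕜] {X : Type*} [NormedAddCommGroup X]
    [NormedSpace 𝕜 X] {N : ℕ} (T : Fin N → X →L[𝕜] X) : Prop :=
  Dense (dHypercyclicVectors T)

/-- A d-hypercyclic manifold of the operators: a linear subspace (not necessarily closed) in which
every nonzero vector is d-hypercyclic. -/
def IsDHypercyclicManifold {𝕜 : Type*} [RCLike 𝕜] {X : Type*} [NormedAddCommGroup X]
    [NormedSpace 𝕜 X] {N : ℕ} (T : Fin N → X →L[𝕜] X) (V : Submodule 𝕜 X) : Prop :=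
  ∀ x ∈ V, x ≠ 0 → x ∈ dHypercyclicVectors T

open Filter Topology Polynomial

theorem exists_dual_eq_one_of_notMem {𝕜 X : Type*} [RCLike 𝕜] [NormedAddCommGroup X]
    [NormedSpace 𝕜 X] (F : Submodule 𝕜 X) [FiniteDimensional 𝕜 F] {x : X} (hx : x ∉ F) :
    ∃ f : X →L[𝕜] 𝕜, (∀ y ∈ F, f y = 0) ∧ f x = 1 := by
  have : IsClosed (F : Set X) := F.closed_of_finiteDimensional
  obtain ⟨g, hg⟩ := SeparatingDual.exists_eq_one (R := 𝕜) (x := F.mkQ x)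
    (by simpa using hx)
  refine ⟨g.comp F.mkQL, fun y hy => ?_, by simpa using hg⟩
  have : F.mkQ y = 0 := by simpa using hy
  change g (F.mkQ y) = 0
  rw [this, map_zero]

theorem finiteDimensional_of_dense {𝕜 X : Type*} [RCLike 𝕜] [NormedAddCommGroup X]
    [NormedSpace 𝕜 X] (V : Submodule 𝕜 X) [FiniteDimensional 𝕜 V] (hV : Dense (V : Set X)) :
    FiniteDimensional 𝕜 X := by
  have hcl : IsClosed (V : Set X) := V.closed_of_finiteDimensional
  obtain rfl : V = ⊤ := SetLike.coe_injective (by rw [← hcl.closure_eq, hV.closure_eq]; rfl)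
  exact Module.Finite.equiv (Submodule.topEquiv : (⊤ : Submodule 𝕜 X) ≃ₗ[𝕜] X)

theorem exists_linearIndependent_nat_dense_span {𝕜 X : Type*} [RCLike 𝕜] [NormedAddCommGroup X]
    [NormedSpace 𝕜 X] [TopologicalSpace.SeparableSpace X] (hX : ¬ FiniteDimensional 𝕜 X) :
    ∃ d : ℕ → X, LinearIndependent 𝕜 d ∧ Dense (Submodule.span 𝕜 (Set.range d) : Set X) := by
  obtain ⟨s, hsc, hsd⟩ := TopologicalSpace.exists_countable_dense X
  obtain ⟨b, hbs, hspan, hli⟩ := exists_linearIndependent 𝕜 s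
  have hd : Dense (Submodule.span 𝕜 b : Set X) := by
    rw [hspan]; exact hsd.mono Submodule.subset_span
  have hinf : Infinite b := by
    by_contra hfin
    rw [not_infinite_iff_finite] at hfin
    have hbf : b.Finite := hfin
    have : FiniteDimensional 𝕜 (Submodule.span 𝕜 b) := FiniteDimensional.span_of_finite 𝕜 hbf
    exact hX (finiteDimensional_of_dense _ hd)
  have : Countable b := (hsc.mono hbs).to_subtype
  obtain ⟨φ⟩ := nonempty_denumerable b
  let e : ℕ ≃ b := (Denumerable.eqv b).symm
  refine ⟨fun n => (e n : X), hli.comp e e.injective, ?_⟩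
  have : Set.range (fun n => (e n : X)) = b := by
    rw [show (fun n => (e n : X)) = Subtype.val ∘ e from rfl, Set.range_comp, e.surjective.range_eq,
      Set.image_univ, Subtype.range_coe]
  rwa [this]

/-- The vectors obtained from `d` by successively subtracting the components along the functionals
`f`. -/
noncomputable def biorthogonalize {𝕜 X : Type*} [RCLike 𝕜] [NormedAddCommGroup X]
    [NormedSpace 𝕜 X] (d : ℕ → X) (f : ℕ → X →L[𝕜] 𝕜) : ℕ → X
  | n => d n - ∑ i : Fin n, f i (d n) • biorthogonalize d f i

theorem exists_biorthogonal_dense_span {𝕜 X : Type*} [RCLike 𝕜] [NormedAddCommGroup X]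
    [NormedSpace 𝕜 X] [TopologicalSpace.SeparableSpace X] (hX : ¬ FiniteDimensional 𝕜 X) :
    ∃ (x : ℕ → X) (f : ℕ → X →L[𝕜] 𝕜), (∀ n, f n (x n) = 1) ∧ (∀ m n, m ≠ n → f m (x n) = 0) ∧
      Dense (Submodule.span 𝕜 (Set.range x) : Set X) := by
  obtain ⟨d, hli, hd⟩ := exists_linearIndependent_nat_dense_span hX
  have hf : ∀ n, ∃ f : X →L[𝕜] 𝕜,
      (∀ y ∈ Submodule.span 𝕜 (d '' Set.Iio n), f y = 0) ∧ f (d n) = 1 := by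
    intro n
    have : FiniteDimensional 𝕜 (Submodule.span 𝕜 (d '' Set.Iio n)) :=
      FiniteDimensional.span_of_finite 𝕜 ((Set.finite_Iio n).image d)
    exact exists_dual_eq_one_of_notMem _ (hli.notMem_span_image (by simp))
  choose f hf0 hf1 using hf
  set x := biorthogonalize d f with hx
  have hrec : ∀ n, x n = d n - ∑ i : Fin n, f i (d n) • x i := fun n => by
    rw [hx, biorthogonalize]
  have hmem : ∀ n, x n ∈ Submodule.span 𝕜 (d '' Set.Iio (n + 1)) := by
    intro n
    induction n using Nat.strong_induction_on with
    | _ n ih =>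
      rw [hrec]
      refine Submodule.sub_mem _ (Submodule.subset_span ⟨n, by simp, rfl⟩)
        (Submodule.sum_mem _ fun i _ => Submodule.smul_mem _ _ ?_)
      exact Submodule.span_mono (Set.image_mono (Set.Iio_subset_Iio (by omega))) (ih i i.2)
  have hlt : ∀ m n, n < m → f m (x n) = 0 := fun m n h =>
    hf0 m _ (Submodule.span_mono (Set.image_mono (Set.Iio_subset_Iio h)) (hmem n))
  have hone : ∀ n, f n (x n) = 1 := by
    intro n
    rw [hrec, map_sub, hf1, map_sum, Finset.sum_eq_zero, sub_zero]
    intro i _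
    rw [map_smul, hlt _ _ i.2, smul_zero]
  have hgt : ∀ n m, m < n → f m (x n) = 0 := by
    intro n
    induction n using Nat.strong_induction_on with
    | _ n ih =>
      intro m hm
      rw [hrec, map_sub, map_sum, Finset.sum_eq_single (⟨m, hm⟩ : Fin n)]
      · simp [hone]
      · intro i _ hi
        rw [map_smul]
        rcases lt_trichotomy (i : ℕ) m with h | h | h
        · rw [hlt _ _ h, smul_zero]
        · exact absurd (Fin.ext h) hi
        · rw [ih i i.2 m h, smul_zero]
      · simp
  refine ⟨x, f, hone, fun m n h => ?_, hd.mono ?_⟩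
  · rcases lt_or_gt_of_ne h with h | h
    · exact hgt _ _ h
    · exact hlt _ _ h
  · refine Submodule.span_le.2 ?_
    rintro _ ⟨n, rfl⟩
    rw [show d n = x n + ∑ i : Fin n, f i (d n) • x i by rw [hrec]; abel]
    exact Submodule.add_mem _ (Submodule.subset_span ⟨n, rfl⟩) (Submodule.sum_mem _ fun i _ =>
      Submodule.smul_mem _ _ (Submodule.subset_span ⟨i, rfl⟩))

/-- A bounded backward shift along a sequence of vectors with dense span. -/
theorem exists_backward_shift {𝕜 X : Type*} [RCLike 𝕜] [NormedAddCommGroup X]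
    [NormedSpace 𝕜 X] [CompleteSpace X] [TopologicalSpace.SeparableSpace X]
    (hX : ¬ FiniteDimensional 𝕜 X) :
    ∃ (S : X →L[𝕜] X) (y : ℕ → X), S (y 0) = 0 ∧ (∀ n, S (y (n + 1)) = y n) ∧
      Dense (Submodule.span 𝕜 (Set.range y) : Set X) := by
  obtain ⟨x, f, hone, hne, hd⟩ := exists_biorthogonal_dense_span hX
  let R : ℕ → X →L[𝕜] X := fun n => (f (n + 1)).smulRight (x n)
  let c : ℕ → ℝ := fun n => (1 / 2) ^ n / (‖R n‖ + 1)
  have hc : ∀ n, 0 < c n := fun n => by positivity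
  have hsum : Summable fun n => (c n : 𝕜) • R n := by
    refine Summable.of_norm_bounded (g := fun n => (1 / 2 : ℝ) ^ n)
      (summable_geometric_of_lt_one (by norm_num) (by norm_num)) fun n => ?_
    rw [norm_smul, RCLike.norm_ofReal, abs_of_pos (hc n), div_mul_eq_mul_div,
      div_le_iff₀ (by positivity)]
    have : (0 : ℝ) ≤ (1 / 2) ^ n := by positivity
    nlinarith
  let S : X →L[𝕜] X := ∑' n, (c n : 𝕜) • R n
  have hS : ∀ v, S v = ∑' n, (c n : 𝕜) • R n v := fun v =>
    ((ContinuousLinearMap.apply 𝕜 X v).map_tsum hsum)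
  have hS0 : S (x 0) = 0 := by
    rw [hS]
    simp [R, hne]
  have hS1 : ∀ n, S (x (n + 1)) = (c n : 𝕜) • x n := fun n => by
    rw [hS, tsum_eq_single n]
    · simp [R, hone]
    · intro m hm
      simp [R, hne _ _ (fun h => hm (Nat.succ_injective h) : m + 1 ≠ n + 1)]
  let a : ℕ → 𝕜 := fun n => ∏ i ∈ Finset.range n, (c i : 𝕜)⁻¹
  have hc0 : ∀ n, (c n : 𝕜) ≠ 0 := fun n => by exact_mod_cast (hc n).ne'
  have ha : ∀ n, a n ≠ 0 := fun n => Finset.prod_ne_zero_iff.2 fun i _ => inv_ne_zero (hc0 i)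
  refine ⟨S, fun n => a n • x n, by simp [hS0], fun n => ?_, hd.mono (Submodule.span_le.2 ?_)⟩
  · change S (a (n + 1) • x (n + 1)) = a n • x n
    rw [map_smul, hS1, smul_smul]
    congr 1
    simp only [a, Finset.prod_range_succ]
    rw [mul_assoc, inv_mul_cancel₀ (hc0 n), mul_one]
  · rintro _ ⟨n, rfl⟩
    rw [show x n = (a n)⁻¹ • a n • x n by rw [smul_smul, inv_mul_cancel₀ (ha n), one_smul]]
    exact Submodule.smul_mem _ _ (Submodule.subset_span ⟨n, rfl⟩)

theorem tendsto_map_eval_C {𝕜 E : Type*} [RCLike 𝕜] [NormedAddCommGroup E] [NormedSpace 𝕜 E]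
    (Φ : 𝕜[X] →ₗ[𝕜] E) (P : 𝕜[X][X]) {s : ℕ → 𝕜} (hs : Tendsto s atTop (𝓝 0)) :
    Tendsto (fun n => Φ (P.eval (C (s n)))) atTop (𝓝 (Φ (P.eval 0))) := by
  have h : ∀ a : 𝕜, Φ (P.eval (C a)) =
      ∑ i ∈ Finset.range (P.natDegree + 1), a ^ i • Φ (P.coeff i) := fun a => by
    rw [eval_eq_sum_range, map_sum]
    refine Finset.sum_congr rfl fun i _ => ?_
    rw [← C_pow, mul_comm, ← smul_eq_C_mul, map_smul]
  have h0 := h 0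
  rw [C_0] at h0
  simp only [h, h0]
  exact tendsto_finsetSum _ fun i _ => (hs.pow i).smul_const _

theorem exists_tendsto_taylor_of_eval {𝕜 E : Type*} [RCLike 𝕜] [NormedAddCommGroup E]
    [NormedSpace 𝕜 E] (Φ : 𝕜[X] →ₗ[𝕜] E) (P Q : 𝕜[X][X])
    (h : ∀ s t : 𝕜, s * t = 1 → taylor t (P.eval (C s)) = Q.eval (C s)) :
    ∃ r : ℕ → 𝕜[X], Tendsto (fun n => Φ (r n)) atTop (𝓝 (Φ (P.eval 0))) ∧
      Tendsto (fun n : ℕ => Φ (taylor (n : 𝕜) (r n))) atTop (𝓝 (Φ (Q.eval 0))) := by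
  have hs : Tendsto (fun n : ℕ => (n : 𝕜)⁻¹) atTop (𝓝 0) := tendsto_inv_atTop_nhds_zero_nat
  refine ⟨fun n => P.eval (C (n : 𝕜)⁻¹), tendsto_map_eval_C Φ P hs,
    (tendsto_map_eval_C Φ Q hs).congr' ?_⟩
  filter_upwards [eventually_ne_atTop 0] with n hn
  rw [h _ _ (inv_mul_cancel₀ (by exact_mod_cast hn))]

theorem exists_tendsto_zero_taylor_tendsto {𝕜 E : Type*} [RCLike 𝕜] [NormedAddCommGroup E]
    [NormedSpace 𝕜 E] (Φ : 𝕜[X] →ₗ[𝕜] E) (p : 𝕜[X]) :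
    ∃ r : ℕ → 𝕜[X], Tendsto (fun n => Φ (r n)) atTop (𝓝 0) ∧
      Tendsto (fun n : ℕ => Φ (taylor (n : 𝕜) (r n))) atTop (𝓝 (Φ p)) := by
  induction p using Polynomial.induction_on' with
  | add p q hp hq =>
    obtain ⟨r, h1, h2⟩ := hp
    obtain ⟨r', h1', h2'⟩ := hq
    refine ⟨r + r', ?_, ?_⟩
    · simpa using h1.add h1'
    · simpa using h2.add h2'
  | monomial k a =>
    have := exists_tendsto_taylor_of_eval Φ
      (C (C a) * X * C X ^ (k + 1) * (X * C X - 1) ^ k)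
      (C (C a) * (X * C X + 1) ^ (k + 1) * C X ^ k) fun s t hst => by
        have hC : (C s : 𝕜[X]) * C t = 1 := by rw [← C_mul, hst, C_1]
        simp only [eval_mul, eval_C, eval_pow, eval_add, eval_sub, eval_X, eval_one, taylor_apply,
          mul_comp, C_comp, pow_comp, X_comp, sub_comp, one_comp]
        rw [show (C s : 𝕜[X]) * (X + C t) - 1 = C s * X by rw [mul_add, hC]; ring,
          show (C s : 𝕜[X]) * X + 1 = C s * (X + C t) by rw [mul_add, hC], mul_pow, mul_pow]
        ring
    simpa [C_mul_X_pow_eq_monomial] using this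

theorem exists_tendsto_taylor_tendsto_zero {𝕜 E : Type*} [RCLike 𝕜] [NormedAddCommGroup E]
    [NormedSpace 𝕜 E] (Φ : 𝕜[X] →ₗ[𝕜] E) (p : 𝕜[X]) :
    ∃ r : ℕ → 𝕜[X], Tendsto (fun n => Φ (r n)) atTop (𝓝 (Φ p)) ∧
      Tendsto (fun n : ℕ => Φ (taylor (n : 𝕜) (r n))) atTop (𝓝 0) := by
  induction p using Polynomial.induction_on' with
  | add p q hp hq =>
    obtain ⟨r, h1, h2⟩ := hp
    obtain ⟨r', h1', h2'⟩ := hq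
    refine ⟨r + r', ?_, ?_⟩
    · simpa using h1.add h1'
    · simpa using h2.add h2'
  | monomial k a =>
    have := exists_tendsto_taylor_of_eval Φ
      (C (C a) * C X ^ k * (1 - X * C X) ^ (k + 1))
      (C (C a) * X * (X * C X + 1) ^ k * (C (C (-1))) ^ (k + 1) * C X ^ (k + 1)) fun s t hst => by
        have hC : (C s : 𝕜[X]) * C t = 1 := by rw [← C_mul, hst, C_1]
        simp only [eval_mul, eval_C, eval_pow, eval_add, eval_sub, eval_X, eval_one,
          taylor_apply, mul_comp, C_comp, pow_comp, X_comp, sub_comp, one_comp]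
        rw [show 1 - (C s : 𝕜[X]) * (X + C t) = C s * (C (-1) * X) by
            rw [mul_add, hC, C_neg, C_1]; ring,
          show (C s : 𝕜[X]) * X + 1 = C s * (X + C t) by rw [mul_add, hC], mul_pow, mul_pow, mul_pow]
        ring
    simpa [C_mul_X_pow_eq_monomial] using this

theorem exists_tendsto_taylor_tendsto {𝕜 E : Type*} [RCLike 𝕜] [NormedAddCommGroup E]
    [NormedSpace 𝕜 E] (Φ : 𝕜[X] →ₗ[𝕜] E) (p q : 𝕜[X]) :
    ∃ r : ℕ → 𝕜[X], Tendsto (fun n => Φ (r n)) atTop (𝓝 (Φ p)) ∧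
      Tendsto (fun n : ℕ => Φ (taylor (n : 𝕜) (r n))) atTop (𝓝 (Φ q)) := by
  obtain ⟨r, h1, h2⟩ := exists_tendsto_taylor_tendsto_zero Φ p
  obtain ⟨r', h1', h2'⟩ := exists_tendsto_zero_taylor_tendsto Φ q
  refine ⟨r + r', ?_, ?_⟩
  · simpa using h1.add h1'
  · simpa using h2.add h2'

theorem exists_exp_intertwining_taylor {𝕜 E : Type*} [RCLike 𝕜] [NormedAddCommGroup E]
    [NormedSpace 𝕜 E] [CompleteSpace E] {S : E →L[𝕜] E} {y : ℕ → E} (h0 : S (y 0) = 0)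
    (hS : ∀ n, S (y (n + 1)) = y n) :
    ∃ Φ : 𝕜[X] →ₗ[𝕜] E, (∀ p, NormedSpace.exp S (Φ p) = Φ (taylor 1 p)) ∧
      Set.range y ⊆ Set.range Φ := by
  let Φ : 𝕜[X] →ₗ[𝕜] E := (basisMonomials 𝕜).constr 𝕜 fun j => (j.factorial : 𝕜) • y j
  have hΦ : ∀ j, Φ (X ^ j) = (j.factorial : 𝕜) • y j := fun j => by
    have := (basisMonomials 𝕜).constr_basis 𝕜 (fun j => (j.factorial : 𝕜) • y j) j
    simpa only [coe_basisMonomials, monomial_one_right_eq_X_pow] using this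
  have hpow : ∀ k j, (S ^ k) (y (j + k)) = y j := by
    intro k
    induction k with
    | zero => intro j; simp
    | succ k ih =>
      intro j
      rw [pow_succ, mul_apply_eq_comp, ← add_assoc, hS, ih]
  have hpow0 : ∀ k j, j < k → (S ^ k) (y j) = 0 := by
    intro k j h
    obtain ⟨i, rfl⟩ := Nat.exists_eq_add_of_lt h
    have := hpow j 0
    rw [zero_add] at this
    rw [show j + i + 1 = i + (1 + j) by ring, pow_add, pow_add,
      mul_apply_eq_comp, mul_apply_eq_comp, this, pow_one,
      h0, map_zero]
  have hexp : ∀ j, NormedSpace.exp S (y j) =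
      ∑ k ∈ Finset.range (j + 1), ((k.factorial : 𝕜)⁻¹) • y (j - k) := by
    intro j
    have hsum := (ContinuousLinearMap.apply 𝕜 E (y j)).hasSum
      (NormedSpace.exp_series_hasSum_exp' (𝕂 := 𝕜) S)
    refine hsum.unique ?_
    rw [show ∑ k ∈ Finset.range (j + 1), ((k.factorial : 𝕜)⁻¹) • y (j - k) =
        ∑ k ∈ Finset.range (j + 1), ContinuousLinearMap.apply 𝕜 E (y j)
          ((k.factorial : 𝕜)⁻¹ • S ^ k) from ?_]
    · refine hasSum_sum_of_ne_finset_zero fun k hk => ?_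
      simp [hpow0 k j (by simpa using hk)]
    · refine Finset.sum_congr rfl fun k hk => ?_
      have hk : k ≤ j := by simpa [Nat.lt_succ_iff] using hk
      have := hpow k (j - k)
      rw [Nat.sub_add_cancel hk] at this
      simp [this]
  refine ⟨Φ, fun p => ?_, ?_⟩
  · induction p using Polynomial.induction_on' with
    | add p q hp hq => simp only [map_add, hp, hq]
    | monomial j a =>
      rw [← C_mul_X_pow_eq_monomial, ← smul_eq_C_mul]
      simp only [map_smul]
      congr 1
      rw [hΦ, map_smul, hexp, taylor_X_pow, C_1, add_comm X 1, add_pow, map_sum, Finset.smul_sum]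
      refine Finset.sum_congr rfl fun k hk => ?_
      have hk : k ≤ j := by simpa [Nat.lt_succ_iff] using hk
      have hk0 : (k.factorial : 𝕜) ≠ 0 := by exact_mod_cast k.factorial_ne_zero
      rw [one_pow, one_mul, mul_comm, ← C_eq_natCast, ← smul_eq_C_mul, map_smul, hΦ, smul_smul,
        smul_smul]
      congr 1
      rw [← Nat.choose_mul_factorial_mul_factorial hk]
      push_cast
      field_simp
  · rintro _ ⟨n, rfl⟩
    refine ⟨(n.factorial : 𝕜)⁻¹ • X ^ n, ?_⟩
    have : (n.factorial : 𝕜) ≠ 0 := by exact_mod_cast n.factorial_ne_zero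
    rw [map_smul, hΦ, smul_smul, inv_mul_cancel₀ this, one_smul]

/-- Every separable infinite-dimensional Banach space supports a topologically mixing operator. -/
theorem exists_mixing_operator {𝕜 E : Type*} [RCLike 𝕜] [NormedAddCommGroup E]
    [NormedSpace 𝕜 E] [CompleteSpace E] [TopologicalSpace.SeparableSpace E]
    (hE : ¬ FiniteDimensional 𝕜 E) :
    ∃ (T : E →L[𝕜] E) (D : Set E), Dense D ∧ (∀ k : ℕ, DenseRange (T ^ k)) ∧ ∀ p ∈ D, ∀ q ∈ D,
      ∃ u : ℕ → E, Tendsto u atTop (𝓝 p) ∧ Tendsto (fun n => (T ^ n) (u n)) atTop (𝓝 q) := by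
  obtain ⟨S, y, h0, hS, hd⟩ := exists_backward_shift hE
  obtain ⟨Φ, hΦ, hy⟩ := exists_exp_intertwining_taylor h0 hS
  have hpow : ∀ (n : ℕ) p, (NormedSpace.exp S ^ n) (Φ p) = Φ (taylor (n : 𝕜) p) := by
    intro n p
    induction n with
    | zero => simp
    | succ n ih =>
      rw [pow_succ', mul_apply_eq_comp, ih, hΦ, taylor_taylor, add_comm,
        Nat.cast_succ]
  have hD : Dense (Set.range Φ) := by
    rw [← LinearMap.coe_range] at hy ⊢
    exact hd.mono (Submodule.span_le.2 hy)
  refine ⟨NormedSpace.exp S, Set.range Φ, hD, fun k => hD.mono ?_, ?_⟩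
  · rintro _ ⟨p, rfl⟩
    exact ⟨Φ (taylor (-(k : 𝕜)) p), by rw [hpow, taylor_taylor, add_neg_cancel, taylor_zero]⟩
  · rintro _ ⟨p, rfl⟩ _ ⟨q, rfl⟩
    obtain ⟨r, h1, h2⟩ := exists_tendsto_taylor_tendsto Φ p q
    exact ⟨fun n => Φ (r n), h1, by simpa only [hpow] using h2⟩

theorem exists_dense_joint_orbit {𝕜 E ι : Type*} [RCLike 𝕜] [NormedAddCommGroup E]
    [NormedSpace 𝕜 E] [CompleteSpace E] [TopologicalSpace.SeparableSpace E] [Finite ι]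
    {T : E →L[𝕜] E} {D : Set E} (hD : Dense D)
    (h : ∀ p ∈ D, ∀ q ∈ D, ∃ u : ℕ → E,
      Tendsto u atTop (𝓝 p) ∧ Tendsto (fun n => (T ^ n) (u n)) atTop (𝓝 q)) :
    ∃ v : ι → E, Dense (Set.range fun n : ℕ => fun i => (T ^ n) (v i)) := by
  have := Fintype.ofFinite ι
  have := UniformSpace.secondCountable_of_separable E
  let B := TopologicalSpace.countableBasis (ι → E)
  have hDpi : Dense (Set.univ.pi fun _ : ι => D) := dense_pi _ fun _ _ => hD
  have hopen : ∀ U : B, IsOpen (⋃ n : ℕ, (fun v : ι → E => fun i => (T ^ n) (v i)) ⁻¹' U) :=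
    fun U => isOpen_iUnion fun n =>
      (TopologicalSpace.isOpen_of_mem_countableBasis U.2).preimage (by fun_prop)
  have hdense : ∀ U : B,
      Dense (⋃ n : ℕ, (fun v : ι → E => fun i => (T ^ n) (v i)) ⁻¹' U) := fun U => by
    rw [dense_iff_inter_open]
    intro W hW hWne
    have hU := TopologicalSpace.isOpen_of_mem_countableBasis U.2
    obtain ⟨p, hpW, hpD⟩ := hDpi.inter_open_nonempty W hW hWne
    obtain ⟨q, hqU, hqD⟩ := hDpi.inter_open_nonempty _ hU
      (TopologicalSpace.nonempty_of_mem_countableBasis U.2)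
    choose u hu hTu using fun i => h (p i) (hpD i trivial) (q i) (hqD i trivial)
    have h1 : Tendsto (fun n i => u i n) atTop (𝓝 p) := tendsto_pi_nhds.2 hu
    have h2 : Tendsto (fun n i => (T ^ n) (u i n)) atTop (𝓝 q) := tendsto_pi_nhds.2 hTu
    obtain ⟨n, hn1, hn2⟩ := ((h1.eventually_mem (hW.mem_nhds hpW)).and
      (h2.eventually_mem (hU.mem_nhds hqU))).exists
    exact ⟨fun i => u i n, hn1, Set.mem_iUnion.2 ⟨n, hn2⟩⟩
  have : Countable B := (TopologicalSpace.countable_countableBasis _).to_subtype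
  obtain ⟨v, hv⟩ := (dense_iInter_of_isOpen hopen hdense).nonempty
  refine ⟨v, (TopologicalSpace.isBasis_countableBasis _).dense_iff.2 fun U hU _ => ?_⟩
  obtain ⟨n, hn⟩ := Set.mem_iUnion.1 (Set.mem_iInter.1 hv ⟨U, hU⟩)
  exact ⟨_, hn, n, rfl⟩

theorem finrank_eq_one_of_forall_ne_zero {𝕜 E : Type*} [Field 𝕜] [AddCommGroup E] [Module 𝕜 E]
    (f : E →ₗ[𝕜] 𝕜) {V : Submodule 𝕜 E} (hV : V ≠ ⊥) (h : ∀ x ∈ V, x ≠ 0 → f x ≠ 0) :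
    FiniteDimensional 𝕜 V ∧ Module.finrank 𝕜 V = 1 := by
  have hinj : Function.Injective (f.domRestrict V) := by
    rw [← LinearMap.ker_eq_bot, LinearMap.ker_eq_bot']
    intro x hx
    by_contra hne
    exact h x x.2 (by simpa using hne) hx
  have hfin : FiniteDimensional 𝕜 V := FiniteDimensional.of_injective _ hinj
  refine ⟨hfin, le_antisymm ?_ ?_⟩
  · simpa using LinearMap.finrank_le_finrank_of_injective hinj
  · exact Nat.one_le_iff_ne_zero.2 fun h0 => hV (Submodule.finrank_eq_zero.1 h0)

/-- The rank-one perturbation `x ↦ x + f x • e` of the identity with `f e = 0`, as a unit. -/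
def transvectionUnit {𝕜 E : Type*} [RCLike 𝕜] [NormedAddCommGroup E] [NormedSpace 𝕜 E]
    (f : E →L[𝕜] 𝕜) (e : E) (h : f e = 0) : (E →L[𝕜] E)ˣ where
  val := 1 + f.smulRight e
  inv := 1 - f.smulRight e
  val_inv := by ext x; simp [h]
  inv_val := by ext x; simp [h]

theorem transvectionUnit_apply {𝕜 E : Type*} [RCLike 𝕜] [NormedAddCommGroup E] [NormedSpace 𝕜 E]
    (f : E →L[𝕜] 𝕜) (e : E) (h : f e = 0) (x : E) :
    (transvectionUnit f e h : E →L[𝕜] E) x = x + f x • e := by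
  simp [transvectionUnit]

theorem corollary3p3 {𝕜 : Type*} [RCLike 𝕜] {X : Type*} [NormedAddCommGroup X]
    [NormedSpace 𝕜 X] [CompleteSpace X] [TopologicalSpace.SeparableSpace X]
    (hX : ¬ FiniteDimensional 𝕜 X) (N : ℕ) (hN : 2 ≤ N) :
    ∃ T : Fin N → X →L[𝕜] X,
      DenselyDHypercyclic T ∧
      (¬ ∃ V : Submodule 𝕜 X, IsDHypercyclicManifold T V ∧ Dense (V : Set X)) ∧
      ∀ V : Submodule 𝕜 X, V ≠ ⊥ → (V : Set X) ⊆ dHypercyclicVectors T ∪ {0} →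
        Module.finrank 𝕜 V = 1 := by
  have hnt : Nontrivial X := by
    by_contra h
    rw [not_nontrivial_iff_subsingleton] at h
    exact hX inferInstance
  obtain ⟨A, D, hD, hrange, hmix⟩ := exists_mixing_operator hX
  obtain ⟨v, hv⟩ := exists_dense_joint_orbit (ι := Fin N) hD hmix
  let i₀ : Fin N := ⟨0, by omega⟩
  let i₁ : Fin N := ⟨1, by omega⟩
  have hi : i₀ ≠ i₁ := by simp [i₀, i₁]
  let e : Fin N → X := Function.update v i₀ 0
  have he₀ : e i₀ = 0 := Function.update_self ..
  have he : ∀ i, i ≠ i₀ → e i = v i := fun i h => Function.update_of_ne h ..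
  obtain ⟨f, hf, a, ha⟩ : ∃ f : X →L[𝕜] 𝕜, (∀ i, f (e i) = 0) ∧ ∃ a, f a = 1 := by
    have := FiniteDimensional.span_of_finite 𝕜 (Set.finite_range e)
    obtain ⟨a, ha⟩ : ∃ a, a ∉ Submodule.span 𝕜 (Set.range e) := by
      by_contra! h
      exact hX (finiteDimensional_of_dense _ fun x => subset_closure (h x))
    obtain ⟨f, hf, hfa⟩ := exists_dual_eq_one_of_notMem (Submodule.span 𝕜 (Set.range e)) ha
    exact ⟨f, fun i => hf _ (Submodule.subset_span ⟨i, rfl⟩), a, hfa⟩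
  let L : Fin N → (X →L[𝕜] X)ˣ := fun i => transvectionUnit f (e i) (hf i)
  have hL : ∀ i x, (L i : X →L[𝕜] X) x = x + f x • e i := fun i x =>
    transvectionUnit_apply f (e i) (hf i) x
  have hLinv : ∀ i x, (L i : X →L[𝕜] X) ((((L i)⁻¹ : (X →L[𝕜] X)ˣ) : X →L[𝕜] X) x) = x :=
    fun i x => by rw [← mul_apply_eq_comp, Units.mul_inv]; rfl
  have hinvL : ∀ i x, (((L i)⁻¹ : (X →L[𝕜] X)ˣ) : X →L[𝕜] X) ((L i : X →L[𝕜] X) x) = x :=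
    fun i x => by rw [← mul_apply_eq_comp, Units.inv_mul]; rfl
  let T : Fin N → X →L[𝕜] X := fun i => ((L i)⁻¹ : (X →L[𝕜] X)ˣ) * A * (L i : X →L[𝕜] X)
  have hT : ∀ i n x, (T i ^ n) x =
      (((L i)⁻¹ : (X →L[𝕜] X)ˣ) : X →L[𝕜] X) ((A ^ n) x + f x • (A ^ n) (e i)) := by
    intro i n x
    rw [Units.conj_pow', mul_apply_eq_comp,
      mul_apply_eq_comp, hL, map_add, map_smul]
  have hne : ∀ x ∈ dHypercyclicVectors T, f x ≠ 0 := by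
    intro x hx hfx
    have hcl : IsClosed {z : Fin N → X | (L i₀ : X →L[𝕜] X) (z i₀) = (L i₁ : X →L[𝕜] X) (z i₁)} :=
      isClosed_eq (by fun_prop) (by fun_prop)
    have hsub : (Set.range fun n : ℕ => fun i : Fin N => (T i ^ n) x) ⊆
        {z : Fin N → X | (L i₀ : X →L[𝕜] X) (z i₀) = (L i₁ : X →L[𝕜] X) (z i₁)} := by
      rintro _ ⟨n, rfl⟩
      change (L i₀ : X →L[𝕜] X) ((T i₀ ^ n) x) = (L i₁ : X →L[𝕜] X) ((T i₁ ^ n) x)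
      rw [hT, hT, hLinv, hLinv, hfx, zero_smul, zero_smul]
    obtain ⟨y, hy⟩ := exists_ne (0 : X)
    have hmem := hcl.closure_subset_iff.2 hsub (hx (Pi.single i₀ y))
    have h0 : (L i₀ : X →L[𝕜] X) y = 0 := by simpa [Pi.single_eq_of_ne hi.symm] using hmem
    rw [hL, he₀, smul_zero, add_zero] at h0
    exact hy h0
  have hone : ∀ V : Submodule 𝕜 X, V ≠ ⊥ → IsDHypercyclicManifold T V →
      FiniteDimensional 𝕜 V ∧ Module.finrank 𝕜 V = 1 := fun V hV h =>
    finrank_eq_one_of_forall_ne_zero (f : X →ₗ[𝕜] 𝕜) hV fun x hx hx0 => hne x (h x hx hx0)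
  refine ⟨T, ?_, ?_, fun V hV hsub => (hone V hV fun x hx hx0 => (hsub hx).resolve_right hx0).2⟩
  · have hmem : ∀ k : ℕ, f ((A ^ k) (v i₀)) ≠ 0 → (A ^ k) (v i₀) ∈ dHypercyclicVectors T := by
      intro k hk
      set c := f ((A ^ k) (v i₀)) with hc
      let G₁ : (Fin N → X) → Fin N → X := Pi.map fun i => if i = i₀ then ⇑(A ^ k) else id
      let G₂ : (Fin N → X) → Fin N → X := fun w i =>
        (((L i)⁻¹ : (X →L[𝕜] X)ˣ) : X →L[𝕜] X) (w i₀ + if i = i₀ then 0 else c • w i)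
      have hG₁ : DenseRange G₁ := DenseRange.piMap fun i => by
        split_ifs
        · exact hrange k
        · exact denseRange_id
      have hG₂ : Function.Surjective G₂ := fun z => by
        refine ⟨fun i => if i = i₀ then (L i₀ : X →L[𝕜] X) (z i₀) else
          c⁻¹ • ((L i : X →L[𝕜] X) (z i) - (L i₀ : X →L[𝕜] X) (z i₀)), ?_⟩
        funext i
        by_cases h : i = i₀
        · subst h
          simp [G₂, hinvL]
        · simp [G₂, h, hk, hinvL]
      have hG₁c : Continuous G₁ := continuous_pi fun i => by
        by_cases h : i = i₀
        · simp only [G₁, Pi.map, h, if_true]; fun_prop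
        · simp only [G₁, Pi.map, h, if_false]; fun_prop
      have hG₂c : Continuous G₂ := continuous_pi fun i => by
        by_cases h : i = i₀
        · simp only [G₂, h, if_true]; fun_prop
        · simp only [G₂, h, if_false]; fun_prop
      have hd := (hG₂.denseRange.comp hG₁ hG₂c).dense_image (hG₂c.comp hG₁c) hv
      refine hd.mono ?_
      rintro _ ⟨_, ⟨n, rfl⟩, rfl⟩
      refine ⟨n, ?_⟩
      funext i
      have hcomm : (A ^ n) ((A ^ k) (v i₀)) = (A ^ k) ((A ^ n) (v i₀)) := by
        rw [← mul_apply_eq_comp, ← mul_apply_eq_comp,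
          ← pow_add, ← pow_add, add_comm]
      simp only [hT, ← hc, hcomm]
      by_cases h : i = i₀
      · subst h
        simp [G₁, G₂, he₀]
      · simp [G₁, G₂, he i h, h]
    have horb : Dense (Set.range fun k : ℕ => (A ^ k) (v i₀)) := by
      have := (Function.surjective_eval (β := fun _ : Fin N => X) i₀).denseRange.dense_image
        (continuous_apply i₀) hv
      rwa [← Set.range_comp] at this
    have hopen : IsOpen {x : X | f x ≠ 0} := isOpen_ne_fun (by fun_prop) continuous_const
    have hdne : Dense {x : X | f x ≠ 0} := by
      have := dense_compl_singleton (0 : 𝕜)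
      refine this.preimage (f.isOpenMap fun c => ⟨c • a, by simp [ha]⟩)
    refine (hdne.inter_of_isOpen_left horb hopen).mono ?_
    rintro _ ⟨hx, k, rfl⟩
    exact hmem k hx
  · rintro ⟨V, hV, hVd⟩
    have hbot : V ≠ ⊥ := by
      rintro rfl
      obtain ⟨y, hy⟩ := exists_ne (0 : X)
      have := hVd y
      simp at this
      exact hy this
    have := (hone V hbot hV).1
    exact hX (finiteDimensional_of_dense V hVd)
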